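/- **Theorem 2 (Price of Anarchy).** Consider a mean-estimation task with a finite nonempty set of players. Player $i$ has $n_i \ge 1$ ($n_i\in\mathbb{N}$) samples. The players' parameters $(\theta_i,\epsilon_i)$ are drawn independently from a common distribution $\Theta$ on $\mathbb{R}^2$ with $\mathbb{E}[\theta_i^2]<\infty$ and $\mathbb{E}|\epsilon_i|<\infty$; given the parameters, all samples are independent, and the $n_i$ samples of player $i$ are drawn i.i.d. from a distribution $\mathcal{D}_i(\theta_i,\epsilon_i)$ on $\mathbb{R}$ with mean $\theta_i$ and variance $\epsilon_i$. Assume that $\mu_e := \mathbb{E}[\epsilon_i] > 0$. Let $\hat\theta_i$ be the empirical mean of player $i$'s samples. A coalition $C$ of players uses the estimate $$\hat\theta_C = \frac{\sum_{i\in C} n_i\hat\theta_i}{\sum_{i\in C} n_i},$$ and the error of a player $j \in C$ is $\mathrm{err}_j(C) = \mathbb{E}\big[(\hat\theta_C-\theta_j)^2\big]$. The cost of a partition $\Pi$ of the players into (nonempty) coalitions is $$f_w(\Pi) = \sum_{C\in\Pi}\sum_{i\in C} n_i\,\mathrm{err}_i(C).$$ A partition $\Pi$ is *individually stable* if there are no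 player $i$, belonging to a coalition $C_i\in\Pi$, and set $C$ with $i\notin C$ that is either a coalition of $\Pi$ or empty, such that $\mathrm{err}_i(C\cup\{i\})<\mathrm{err}_i(C_i)$ and $\mathrm{err}_k(C\cup\{i\})\le \mathrm{err}_k(C)$ for all $k\in C$. Let $\Pi_M$ be an individually stable partition whose cost is maximal among all individually stable partitions, and let $\Pi_{opt}$ be a partition whose cost is minimal among all partitions. Then $f_w(\Pi_{opt})>0$ and $$\mathrm{PoA} = \frac{f_w(\Pi_M)}{f_w(\Pi_{opt})} \le 9 .$$ -/

import Mathlib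

open MeasureTheory ProbabilityTheory

/-- A mean-estimation task for a finite set `ι` of players.  Player `i` has `samples i` data points.
Each player's true parameters `(θ, ε)` (mean and noise variance) are drawn independently from the
common law `paramLaw`; given `(θ, ε)`, the data of player `i` are drawn i.i.d. from
`dataLaw i (θ, ε)`, a distribution on `ℝ` with mean `θ` and variance `ε`. -/
structure MeanEstimation (ι : Type*) where
  samples : ι → ℕ
  samples_pos : ∀ i, 0 < samples i
  paramLaw : Measure (ℝ × ℝ)
  paramLaw_prob : IsProbabilityMeasure paramLaw
  dataLaw : ι → Kernel (ℝ × ℝ) ℝ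
  dataLaw_prob : ∀ i, IsMarkovKernel (dataLaw i)
  memLp_mean : MemLp (fun p : ℝ × ℝ => p.1) 2 paramLaw
  integrable_noise : Integrable (fun p : ℝ × ℝ => p.2) paramLaw
  data_memLp : ∀ i, ∀ᵐ p ∂paramLaw, MemLp (fun y : ℝ => y) 2 (dataLaw i p)
  data_mean : ∀ i, ∀ᵐ p ∂paramLaw, ∫ y, y ∂(dataLaw i p) = p.1
  data_variance : ∀ i, ∀ᵐ p ∂paramLaw, variance (fun y : ℝ => y) (dataLaw i p) = p.2

namespace MeanEstimation

noncomputable section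

variable {ι : Type*} [Fintype ι] [DecidableEq ι] (G : MeanEstimation ι)

/-- The average sampling noise `μ_e`, the expectation of `ε`. -/
def meanNoise : ℝ := ∫ p, p.2 ∂G.paramLaw

/-- A realization of the data of all the players: the `k`-th data point of player `i` is
`y ⟨i, k⟩`. -/
abbrev Data : Type _ := (Σ i : ι, Fin (G.samples i)) → ℝ

/-- The law of the data, given the true parameters `p i = (θ i, ε i)` of the players. -/
def sampleLaw (p : ι → ℝ × ℝ) : Measure G.Data :=
  Measure.pi fun s : (Σ i : ι, Fin (G.samples i)) => G.dataLaw s.1 (p s.1)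

/-- The local estimate of player `i`: its empirical mean. -/
def localEst (y : G.Data) (i : ι) : ℝ :=
  (∑ k : Fin (G.samples i), y ⟨i, k⟩) / (G.samples i : ℝ)

/-- The federated estimate of a coalition: the sample-weighted average of the local estimates. -/
def fedEst (C : Finset ι) (y : G.Data) : ℝ :=
  (∑ i ∈ C, (G.samples i : ℝ) * G.localEst y i) / ∑ i ∈ C, (G.samples i : ℝ)

/-- The error of player `j` in the coalition `C` (used for `j ∈ C`): the expected squared distance
of the federated estimate to the true mean of `j`, over the parameters and the data. -/
def err (j : ι) (C : Finset ι) : ℝ :=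
  ∫ p : ι → ℝ × ℝ, (∫ y, (G.fedEst C y - (p j).1) ^ 2 ∂(G.sampleLaw p))
    ∂(Measure.pi fun _ : ι => G.paramLaw)

/-- The cost of a coalition: the sample-weighted sum of its members' errors. -/
def coalitionCost (C : Finset ι) : ℝ := ∑ i ∈ C, (G.samples i : ℝ) * G.err i C

/-- The cost of a partition of the players into coalitions. -/
def cost (P : Finpartition (Finset.univ : Finset ι)) : ℝ := ∑ C ∈ P.parts, G.coalitionCost C

/-- A partition is optimal if its cost is minimal among all partitions. -/
def IsOptimal (P : Finpartition (Finset.univ : Finset ι)) : Prop := ∀ Q, G.cost P ≤ G.cost Q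

/-- Individual stability: no player `i` strictly prefers to leave its coalition for another one, or
for the empty one (that is, for being alone), all of whose members weakly prefer that `i` joins. -/
def IsIndividuallyStable (P : Finpartition (Finset.univ : Finset ι)) : Prop :=
  ¬ ∃ (i : ι) (C : Finset ι), (C ∈ P.parts ∨ C = ∅) ∧ i ∉ C ∧
    G.err i (insert i C) < G.err i (P.part i) ∧ ∀ k ∈ C, G.err k (insert i C) ≤ G.err k C

/-- A maximum-cost individually stable partition. -/
def IsWorstStable (P : Finpartition (Finset.univ : Finset ι)) : Prop :=
  G.IsIndividuallyStable P ∧ ∀ Q, G.IsIndividuallyStable Q → G.cost Q ≤ G.cost P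

end

end MeanEstimation

/-- The mean square of an affine combination of independent square-integrable variables. -/
theorem integral_sq_sum_pi {κ : Type*} [Fintype κ] {Ω : κ → Type*} [∀ s, MeasurableSpace (Ω s)]
    (ν : ∀ s, Measure (Ω s)) [∀ s, IsProbabilityMeasure (ν s)] {X : ∀ s, Ω s → ℝ}
    (hX : ∀ s, MemLp (X s) 2 (ν s)) (c : κ → ℝ) (d : ℝ) :
    ∫ y, (∑ s, c s * X s (y s) - d) ^ 2 ∂(Measure.pi ν) =
      ∑ s, c s ^ 2 * variance (X s) (ν s) + (∑ s, c s * ∫ x, X s x ∂(ν s) - d) ^ 2 := by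
  have hcX : ∀ s, MemLp (fun x => c s * X s x) 2 (ν s) := fun s => (hX s).const_mul _
  have hpi : ∀ s, MemLp (fun y : ∀ s, Ω s => c s * X s (y s)) 2 (Measure.pi ν) := fun s =>
    (hcX s).comp_measurePreserving (measurePreserving_eval ν s)
  have hsum : MemLp (fun y : ∀ s, Ω s => ∑ s, c s * X s (y s)) 2 (Measure.pi ν) :=
    memLp_finsetSum _ fun s _ => hpi s
  have hsub : MemLp (fun y : ∀ s, Ω s => ∑ s, c s * X s (y s) - d) 2 (Measure.pi ν) :=
    hsum.sub (memLp_const d)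
  have hvar := variance_eq_sub hsub
  rw [variance_sub_const hsum.aestronglyMeasurable] at hvar
  have hmean : ∫ y, (∑ s, c s * X s (y s) - d) ∂(Measure.pi ν) =
      ∑ s, c s * ∫ x, X s x ∂(ν s) - d := by
    rw [integral_sub (hsum.integrable (by norm_num)) (integrable_const d),
      integral_finsetSum _ fun s _ => (hpi s).integrable (by norm_num)]
    congr 1
    · refine Finset.sum_congr rfl fun s _ => ?_
      rw [integral_const_mul, integral_comp_eval (hX s).aestronglyMeasurable]
    · simp
  have hv := variance_sum_pi hcX
  simp only [variance_const_mul] at hv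
  have hfun : (∑ s, fun y : ∀ s, Ω s => c s * X s (y s)) = fun y => ∑ s, c s * X s (y s) := by
    ext y; simp
  rw [hfun] at hv
  rw [← hmean, ← hv, hvar]
  simp only [Pi.pow_apply]
  ring

/-! ### Closed form of the error -/

namespace MeanEstimation

variable {ι : Type*} (G : MeanEstimation ι)

/-- The variance `σ²` of the mean parameter. -/
noncomputable def meanVariance : ℝ := variance (fun p : ℝ × ℝ => p.1) G.paramLaw

/-- The number of samples of a coalition. -/
noncomputable def size (C : Finset ι) : ℝ := ∑ i ∈ C, (G.samples i : ℝ)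

/-- The sum of the squared numbers of samples of the members of a coalition. -/
noncomputable def sqSize (C : Finset ι) : ℝ := ∑ i ∈ C, (G.samples i : ℝ) ^ 2

theorem samples_cast_pos (i : ι) : (0 : ℝ) < G.samples i := by exact_mod_cast G.samples_pos i

theorem size_pos {C : Finset ι} (hC : C.Nonempty) : 0 < G.size C :=
  Finset.sum_pos (fun i _ => G.samples_cast_pos i) hC

variable [Fintype ι] [DecidableEq ι]

theorem fedEst_eq_sum (C : Finset ι) (y : G.Data) :
    G.fedEst C y = ∑ s : (Σ i : ι, Fin (G.samples i)),
      (if s.1 ∈ C then (G.size C)⁻¹ else 0) * y s := by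
  have hloc : ∀ i, (G.samples i : ℝ) * G.localEst y i = ∑ k, y ⟨i, k⟩ := fun i =>
    mul_div_cancel₀ _ (G.samples_cast_pos i).ne'
  simp only [fedEst, hloc, Fintype.sum_sigma, ite_mul, zero_mul, size]
  rw [← Finset.sum_filter_add_sum_filter_not Finset.univ (· ∈ C), div_eq_inv_mul, Finset.mul_sum]
  rw [Finset.sum_eq_zero (s := Finset.univ.filter fun x => ¬ x ∈ C), add_zero]
  · rw [Finset.filter_mem_eq_inter, Finset.univ_inter]
    exact Finset.sum_congr rfl fun i hi => by simp [hi, Finset.mul_sum]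
  · intro i hi
    simp [(Finset.mem_filter.1 hi).2]

theorem integral_sampleLaw_sq (C : Finset ι) (d : ℝ) {p : ι → ℝ × ℝ}
    (hp : ∀ i, MemLp (fun y : ℝ => y) 2 (G.dataLaw i (p i)))
    (hmean : ∀ i, ∫ y, y ∂(G.dataLaw i (p i)) = (p i).1)
    (hvar : ∀ i, variance (fun y : ℝ => y) (G.dataLaw i (p i)) = (p i).2) :
    ∫ y, (G.fedEst C y - d) ^ 2 ∂(G.sampleLaw p) =
      ∑ i ∈ C, G.samples i * (G.size C)⁻¹ ^ 2 * (p i).2 +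
        (∑ i ∈ C, G.samples i * (G.size C)⁻¹ * (p i).1 - d) ^ 2 := by
  have := G.dataLaw_prob
  simp only [fedEst_eq_sum, sampleLaw]
  rw [integral_sq_sum_pi (fun s : (Σ i : ι, Fin (G.samples i)) => G.dataLaw s.1 (p s.1))
    (X := fun _ y => y) (fun s => hp s.1)]
  simp only [hmean, hvar, Fintype.sum_sigma, Finset.sum_const, Finset.card_univ, Fintype.card_fin,
    nsmul_eq_mul, ite_mul, zero_mul, ite_pow, mul_ite, mul_zero, Finset.sum_ite_mem,
    Finset.univ_inter, ne_eq, OfNat.ofNat_ne_zero, not_false_eq_true, zero_pow, mul_assoc]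

/-- Given the parameters, the error is sampling variance plus squared bias. The bias is a
combination of the independent θ_i with coefficients n_i/N on the coalition, minus 1 at j. -/
theorem err_eq {j : ι} {C : Finset ι} (hj : j ∈ C) :
    G.err j C = G.meanNoise / G.size C +
      G.meanVariance * (G.sqSize C / G.size C ^ 2 + 1 - 2 * G.samples j / G.size C) := by
  have := G.paramLaw_prob
  have hN := (G.size_pos ⟨j, hj⟩).ne'
  have hae : ∀ {Q : ι → ℝ × ℝ → Prop}, (∀ i, ∀ᵐ q ∂G.paramLaw, Q i q) →
      ∀ᵐ p ∂(Measure.pi fun _ : ι => G.paramLaw), ∀ i, Q i (p i) := fun h =>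
    ae_all_iff.2 fun i => (Measure.quasiMeasurePreserving_eval _ i).ae (h i)
  have hinner : ∀ᵐ p ∂(Measure.pi fun _ : ι => G.paramLaw),
      ∫ y, (G.fedEst C y - (p j).1) ^ 2 ∂(G.sampleLaw p) =
      ∑ i ∈ C, G.samples i * (G.size C)⁻¹ ^ 2 * (p i).2 +
        (∑ i, ((if i ∈ C then G.samples i * (G.size C)⁻¹ else 0) - if i = j then 1 else 0) *
          (p i).1 - 0) ^ 2 := by
    filter_upwards [hae G.data_memLp, hae G.data_mean, hae G.data_variance] with p h1 h2 h3
    rw [G.integral_sampleLaw_sq C _ h1 h2 h3]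
    simp [sub_mul, Finset.sum_sub_distrib]
  have hfst : ∀ i : ι, MemLp (fun p : ι → ℝ × ℝ => (p i).1) 2
      (Measure.pi fun _ : ι => G.paramLaw) := fun i =>
    G.memLp_mean.comp_measurePreserving (measurePreserving_eval (fun _ : ι => G.paramLaw) i)
  have hsnd : ∀ i : ι, Integrable (fun p : ι → ℝ × ℝ => (p i).2)
      (Measure.pi fun _ : ι => G.paramLaw) := fun i =>
    (measurePreserving_eval (fun _ : ι => G.paramLaw) i).integrable_comp_of_integrable
      G.integrable_noise
  rw [err, integral_congr_ae hinner, integral_add, integral_finsetSum,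
    integral_sq_sum_pi (fun _ : ι => G.paramLaw) (X := fun _ q => q.1) fun _ => G.memLp_mean]
  · have hsnd_int : ∀ i : ι, ∫ p : ι → ℝ × ℝ, (p i).2 ∂(Measure.pi fun _ : ι => G.paramLaw) =
        G.meanNoise := fun i =>
      integral_comp_eval (μ := fun _ : ι => G.paramLaw) G.integrable_noise.aestronglyMeasurable
    simp only [integral_const_mul, hsnd_int]
    rw [← Finset.sum_mul, ← Finset.sum_mul, ← Finset.sum_mul, ← Finset.sum_mul]
    -- The coefficients sum to zero, so the common mean of the θ_i drops out and only their variance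
    -- remains.
    have h0 : ∑ i, ((if i ∈ C then G.samples i * (G.size C)⁻¹ else 0) - if i = j then (1 : ℝ) else 0)
        = 0 := by
      simp only [Finset.sum_sub_distrib, Finset.sum_ite_mem, Finset.univ_inter,
        Finset.sum_ite_eq', Finset.mem_univ, if_true]
      rw [← Finset.sum_mul]
      change G.size C * _ - 1 = 0
      rw [mul_inv_cancel₀ hN, sub_self]
    have h2 : ∑ i, ((if i ∈ C then G.samples i * (G.size C)⁻¹ else 0) -
        if i = j then (1 : ℝ) else 0) ^ 2 =
        G.sqSize C / G.size C ^ 2 + 1 - 2 * G.samples j / G.size C := by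
      have : ∀ i, ((if i ∈ C then G.samples i * (G.size C)⁻¹ else 0) -
          if i = j then (1 : ℝ) else 0) ^ 2 =
          (if i ∈ C then (G.samples i : ℝ) ^ 2 * ((G.size C)⁻¹ ^ 2) else 0) +
            if i = j then 1 - 2 * G.samples j * (G.size C)⁻¹ else 0 := by
        intro i
        by_cases hij : i = j
        · subst hij; simp only [hj, if_true]; ring
        · by_cases hi : i ∈ C
          · simp only [hi, hij, if_true, if_false]; ring
          · simp [hi, hij]
      simp only [this, Finset.sum_add_distrib, Finset.sum_ite_mem, Finset.univ_inter,
        Finset.sum_ite_eq', Finset.mem_univ, if_true, ← Finset.sum_mul]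
      rw [sqSize]
      ring
    rw [h0, h2]
    change G.size C * _ * _ + (_ * G.meanVariance + _) = _
    field_simp
    ring
  · exact fun i _ => (hsnd i).const_mul _
  · exact integrable_finsetSum _ fun i _ => (hsnd i).const_mul _
  · exact ((memLp_finsetSum _ fun i _ => (hfst i).const_mul _).sub (memLp_const 0)).integrable_sq

end MeanEstimation

/-! ### Deviations between noise-dominated coalitions -/

/-- In a coalition of size `N` that is small relative to the noise, a member with `m` samples weakly
benefits from the entry of a small player with `n` samples. -/
theorem join_error_le {μ v N S n m : ℝ} (hv : 0 ≤ v) (hN : 0 < N) (hS : 0 ≤ S) (hn : 0 < n)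
    (hmN : m ≤ N) (hvN : 7 * (v * N) ≤ μ) (hvn : 7 * (v * n) ≤ μ) :
    μ / (N + n) + v * ((S + n ^ 2) / (N + n) ^ 2 + 1 - 2 * m / (N + n)) ≤
      μ / N + v * (S / N ^ 2 + 1 - 2 * m / N) := by
  have h1 : S / (N + n) ^ 2 ≤ S / N ^ 2 := by gcongr; linarith
  have h2 : n ^ 2 / (N + n) ^ 2 ≤ n ^ 2 / (N * (N + n)) := by
    rw [sq (N + n)]; gcongr; linarith
  have h3 : μ / N + v * (S / N ^ 2 + 1 - 2 * m / N) -
      (μ / (N + n) + v * ((S + n ^ 2) / (N + n) ^ 2 + 1 - 2 * m / (N + n))) =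
      v * (S / N ^ 2 - S / (N + n) ^ 2) + v * (n ^ 2 / (N * (N + n)) - n ^ 2 / (N + n) ^ 2) +
        n * (μ - v * n - 2 * (v * m)) / (N * (N + n)) := by
    field_simp
    ring
  have hvm : v * m ≤ v * N := by gcongr
  have hvn0 : 0 ≤ v * n := by positivity
  have hvN0 : 0 ≤ v * N := by positivity
  have h4 : 0 ≤ n * (μ - v * n - 2 * (v * m)) / (N * (N + n)) :=
    div_nonneg (mul_nonneg hn.le (by linarith)) (by positivity)
  have h5 := mul_nonneg hv (sub_nonneg.2 h1)
  have h6 := mul_nonneg hv (sub_nonneg.2 h2)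
  linarith

/-- Of two coalitions of sizes `a` and `b` that are small relative to the noise, every member of the
one with the larger value of `μ / N + v * S / N ^ 2` strictly prefers to join the other one. -/
theorem join_error_lt {μ v a b Sa Sb n : ℝ} (hμ : 0 < μ) (hv : 0 ≤ v) (ha : 0 < a) (hb : 0 < b)
    (hSa : 0 ≤ Sa) (hSb : 0 ≤ Sb) (hSb' : Sb ≤ b ^ 2) (hn : 0 < n) (hna : n ≤ a)
    (hva : 7 * (v * a) ≤ μ) (hvb : 7 * (v * b) ≤ μ)
    (h : μ / b + v * (Sb / b ^ 2) ≤ μ / a + v * (Sa / a ^ 2)) :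
    μ / (b + n) + v * ((Sb + n ^ 2) / (b + n) ^ 2 + 1 - 2 * n / (b + n)) <
      μ / a + v * (Sa / a ^ 2 + 1 - 2 * n / a) := by
  have hvn : v * n ≤ v * a := by gcongr
  have hvn0 : 0 ≤ v * n := by positivity
  have hva0 : 0 ≤ v * a := by positivity
  have hvb0 : 0 ≤ v * b := by positivity
  -- If b ≤ 3a/2, the member's share in the old coalition is at most 3/2 of n/b, and the assumed
  -- ordering gives the rest. Otherwise the move cuts the noise term by at least a third, which
  -- outweighs the at most v added by the squares. Both cases need noise to exceed five terms, each
  -- at most μ/7.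
  rcases le_total (2 * b) (3 * a) with hab | hab
  · have h1 : Sb / (b + n) ^ 2 ≤ Sb / b ^ 2 := by gcongr; linarith
    have h2 : n ^ 2 / (b + n) ^ 2 ≤ n / (b + n) := by
      rw [div_le_div_iff₀ (by positivity) (by positivity)]
      have : 0 ≤ n * b * (b + n) := by positivity
      nlinarith
    have h3 : 2 * n / a ≤ 3 * n / b := by
      rw [div_le_div_iff₀ ha hb]
      nlinarith
    have h4 : μ / b - μ / (b + n) + v * (n / (b + n)) - v * (3 * n / b) =
        n * (μ - 2 * (v * b) - 3 * (v * n)) / (b * (b + n)) := by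
      field_simp
      ring
    have h5 : 0 < n * (μ - 2 * (v * b) - 3 * (v * n)) / (b * (b + n)) :=
      div_pos (mul_pos hn (by linarith)) (by positivity)
    have h6 := mul_le_mul_of_nonneg_left h1 hv
    have h7 := mul_le_mul_of_nonneg_left h2 hv
    have h8 := mul_le_mul_of_nonneg_left h3 hv
    have h9 : v * ((Sb + n ^ 2) / (b + n) ^ 2 + 1 - 2 * n / (b + n)) =
        v * (Sb / (b + n) ^ 2) + v * (n ^ 2 / (b + n) ^ 2) + v - 2 * (v * (n / (b + n))) := by
      ring
    rw [h9]
    linarith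
  · have h1 : (Sb + n ^ 2) / (b + n) ^ 2 ≤ 1 := by
      rw [div_le_one (by positivity)]
      nlinarith
    have h2 : 1 / (b + n) ≤ 2 / 3 * (1 / a) := by
      rw [div_mul_div_comm, div_le_div_iff₀ (by positivity) (by positivity)]
      nlinarith
    have h3 : 0 ≤ v * (Sa / a ^ 2) := by positivity
    have h4 : v < (μ - 2 * (v * n)) * (1 / 3 * (1 / a)) := by
      rw [← sub_pos]
      have : (μ - 2 * (v * n)) * (1 / 3 * (1 / a)) - v =
          (μ - 2 * (v * n) - 3 * (v * a)) / (3 * a) := by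
        field_simp
      rw [this]
      exact div_pos (by linarith) (by positivity)
    have h5 : (μ - 2 * (v * n)) * (1 / (b + n)) ≤ (μ - 2 * (v * n)) * (2 / 3 * (1 / a)) :=
      mul_le_mul_of_nonneg_left h2 (by linarith)
    have h6 := mul_le_mul_of_nonneg_left h1 hv
    have h7 : μ / (b + n) + v * ((Sb + n ^ 2) / (b + n) ^ 2 + 1 - 2 * n / (b + n)) =
        (μ - 2 * (v * n)) * (1 / (b + n)) + v * ((Sb + n ^ 2) / (b + n) ^ 2) + v := by ring
    have h8 : μ / a + v * (Sa / a ^ 2 + 1 - 2 * n / a) =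
        (μ - 2 * (v * n)) * (1 / a) + v * (Sa / a ^ 2) + v := by ring
    rw [h7, h8]
    linarith

/-! ### Cost bounds for arbitrary partitions -/

namespace MeanEstimation

variable {ι : Type*} (G : MeanEstimation ι)

theorem meanVariance_nonneg : 0 ≤ G.meanVariance := variance_nonneg _ _

theorem sqSize_nonneg (C : Finset ι) : 0 ≤ G.sqSize C := Finset.sum_nonneg fun _ _ => sq_nonneg _

theorem samples_le_size {C : Finset ι} {i : ι} (hi : i ∈ C) : (G.samples i : ℝ) ≤ G.size C :=
  Finset.single_le_sum (f := fun i => (G.samples i : ℝ))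
    (fun j _ => (G.samples_cast_pos j).le) hi

theorem sqSize_le_size_sq (C : Finset ι) : G.sqSize C ≤ G.size C ^ 2 := by
  rw [sqSize, sq, size, Finset.sum_mul]
  refine Finset.sum_le_sum fun i hi => ?_
  rw [sq]
  exact mul_le_mul_of_nonneg_left (G.samples_le_size hi) (G.samples_cast_pos i).le

/-- The noise-dominated coalitions: those whose size is at most `μ_e / (7 σ²)`. -/
def IsLight (C : Finset ι) : Prop := 7 * (G.meanVariance * G.size C) ≤ G.meanNoise

/-- The weight of a player in the comparison of costs, the smaller one of `μ_e` and `9 σ² n_i`. -/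
noncomputable def cappedWeight (i : ι) : ℝ :=
  min G.meanNoise (9 * (G.meanVariance * G.samples i))

section Insert

variable [DecidableEq ι]

theorem size_insert {C : Finset ι} {i : ι} (hi : i ∉ C) :
    G.size (insert i C) = G.size C + G.samples i := by
  rw [size, Finset.sum_insert hi, add_comm, size]

theorem sqSize_insert {C : Finset ι} {i : ι} (hi : i ∉ C) :
    G.sqSize (insert i C) = G.sqSize C + (G.samples i : ℝ) ^ 2 := by
  rw [sqSize, Finset.sum_insert hi, add_comm, sqSize]

end Insert

variable [Fintype ι] [DecidableEq ι]

theorem coalitionCost_eq {C : Finset ι} (hC : C.Nonempty) :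
    G.coalitionCost C = G.meanNoise + G.meanVariance * (G.size C - G.sqSize C / G.size C) := by
  have hN := (G.size_pos hC).ne'
  have h : ∀ i ∈ C, (G.samples i : ℝ) * G.err i C =
      G.samples i * (G.meanNoise / G.size C +
        G.meanVariance * (G.sqSize C / G.size C ^ 2 + 1)) -
      (G.samples i : ℝ) ^ 2 * (2 * G.meanVariance / G.size C) := fun i hi => by
    rw [G.err_eq hi]; ring
  rw [coalitionCost, Finset.sum_congr rfl h, Finset.sum_sub_distrib, ← Finset.sum_mul,
    ← Finset.sum_mul]
  change G.size C * _ - G.sqSize C * _ = _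
  field_simp
  ring

/-- After clearing N, the claim splits into one inequality per member, using n_i ≤ N and both bounds
on the capped weight. -/
theorem coalitionCost_lower {C : Finset ι} (hC : C.Nonempty) :
    ∑ i ∈ C, G.cappedWeight i + 8 * G.meanNoise ≤ 9 * G.coalitionCost C := by
  have hN := G.size_pos hC
  have key : 9 * (G.meanVariance * G.sqSize C) ≤
      G.size C * (9 * (G.meanVariance * G.size C) - ∑ i ∈ C, G.cappedWeight i) +
        G.size C * G.meanNoise := by
    have hi : ∀ i ∈ C, 9 * (G.meanVariance * (G.samples i : ℝ) ^ 2) ≤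
        G.size C * (9 * (G.meanVariance * G.samples i) - G.cappedWeight i) +
          G.samples i * G.meanNoise := fun i hi => by
      have h1 := mul_le_mul_of_nonneg_right (G.samples_le_size hi)
        (sub_nonneg.2 (min_le_right G.meanNoise (9 * (G.meanVariance * G.samples i))))
      have h2 := mul_le_mul_of_nonneg_left
        (min_le_left G.meanNoise (9 * (G.meanVariance * G.samples i)))
        (G.samples_cast_pos i).le
      rw [cappedWeight]
      linarith
    have h := Finset.sum_le_sum hi
    rwa [← Finset.mul_sum, ← Finset.mul_sum, Finset.sum_add_distrib, ← Finset.mul_sum,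
      Finset.sum_sub_distrib, ← Finset.mul_sum, ← Finset.mul_sum, ← Finset.sum_mul] at h
  rw [G.coalitionCost_eq hC]
  have h : G.sqSize C / G.size C * (9 * G.meanVariance) ≤
      9 * (G.meanVariance * G.size C) - ∑ i ∈ C, G.cappedWeight i + G.meanNoise := by
    rw [div_mul_eq_mul_div, div_le_iff₀ hN]
    linarith
  linarith

theorem sum_parts_sum (P : Finpartition (Finset.univ : Finset ι)) (f : ι → ℝ) :
    ∑ C ∈ P.parts, ∑ i ∈ C, f i = ∑ i, f i := by
  have h := Finset.sum_biUnion (f := f) P.disjoint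
  rw [P.biUnion_parts] at h
  exact h.symm

theorem cost_lower [Nonempty ι] (hnoise : 0 < G.meanNoise)
    (P : Finpartition (Finset.univ : Finset ι)) :
    ∑ i, G.cappedWeight i + 8 * G.meanNoise ≤ 9 * G.cost P := by
  have h := Finset.sum_le_sum fun C hC => G.coalitionCost_lower (P.nonempty_of_mem_parts hC)
  rw [Finset.sum_add_distrib, sum_parts_sum, Finset.sum_const, ← Finset.mul_sum,
    nsmul_eq_mul] at h
  -- A single coalition already supplies the 8μ.
  have hcard : (1 : ℝ) ≤ P.parts.card := by
    exact_mod_cast (P.parts_nonempty Finset.univ_nonempty.ne_empty).card_pos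
  have := mul_le_mul_of_nonneg_right hcard (show 0 ≤ 8 * G.meanNoise by linarith)
  rw [cost]
  linarith

/-! ### Cost bound for stable partitions -/

variable {G} {P : Finpartition (Finset.univ : Finset ι)}

/-- A lone player has error μ/n_i, and nobody can block a move to the empty coalition. -/
theorem IsIndividuallyStable.samples_mul_err_le (h : G.IsIndividuallyStable P) {C : Finset ι}
    (hC : C ∈ P.parts) {i : ι} (hi : i ∈ C) : G.samples i * G.err i C ≤ G.meanNoise := by
  have hn := G.samples_cast_pos i
  by_contra! hlt
  refine h ⟨i, ∅, Or.inr rfl, Finset.notMem_empty i, ?_, by simp⟩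
  rw [P.part_eq_of_mem hC hi, G.err_eq (Finset.mem_insert_self i ∅),
    G.size_insert (Finset.notMem_empty i), G.sqSize_insert (Finset.notMem_empty i)]
  simp only [size, sqSize, Finset.sum_empty, zero_add]
  rw [← div_lt_iff₀' hn] at hlt
  rwa [div_self (pow_ne_zero 2 hn.ne'), mul_div_cancel_right₀ _ hn.ne',
    show (1 : ℝ) + 1 - 2 = 0 by norm_num, mul_zero, add_zero]

/-- With two light coalitions, any member of the one with the larger member-independent part of the
error gains by moving to the other, whose members accept. -/
theorem IsIndividuallyStable.light_unique (h : G.IsIndividuallyStable P)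
    (hnoise : 0 < G.meanNoise) {A B : Finset ι} (hA : A ∈ P.parts) (hB : B ∈ P.parts)
    (hA' : G.IsLight A) (hB' : G.IsLight B) : A = B := by
  wlog hAB : G.meanNoise / G.size B + G.meanVariance * (G.sqSize B / G.size B ^ 2) ≤
      G.meanNoise / G.size A + G.meanVariance * (G.sqSize A / G.size A ^ 2) generalizing A B
  · exact (this hB hA hB' hA' (le_of_not_ge hAB)).symm
  by_contra hne
  obtain ⟨i, hi⟩ := P.nonempty_of_mem_parts hA
  have hiB : i ∉ B := Finset.disjoint_left.1 (P.disjoint hA hB hne) hi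
  have hv := G.meanVariance_nonneg
  have hn := G.samples_cast_pos i
  have hna := G.samples_le_size hi
  have hb := G.size_pos (P.nonempty_of_mem_parts hB)
  refine h ⟨i, B, Or.inl hB, hiB, ?_, fun k hk => ?_⟩
  · rw [P.part_eq_of_mem hA hi, G.err_eq hi, G.err_eq (Finset.mem_insert_self i B),
      G.size_insert hiB, G.sqSize_insert hiB]
    exact join_error_lt hnoise hv (hn.trans_le hna) hb (G.sqSize_nonneg A) (G.sqSize_nonneg B)
      (G.sqSize_le_size_sq B) hn hna hA' hB' hAB
  · rw [G.err_eq hk, G.err_eq (Finset.mem_insert_of_mem hk), G.size_insert hiB,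
      G.sqSize_insert hiB]
    have := mul_le_mul_of_nonneg_left hna hv
    have hA'' : 7 * (G.meanVariance * G.size A) ≤ G.meanNoise := hA'
    exact join_error_le hv hb (G.sqSize_nonneg B) hn (G.samples_le_size hk) hB' (by linarith)

theorem IsIndividuallyStable.coalitionCost_le_of_not_light (h : G.IsIndividuallyStable P)
    {C : Finset ι} (hC : C ∈ P.parts) (hC' : ¬ G.IsLight C) :
    G.coalitionCost C ≤ ∑ i ∈ C, G.cappedWeight i := by
  refine Finset.sum_le_sum fun i hi => le_min (h.samples_mul_err_le hC hi) ?_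
  have hN := G.size_pos ⟨i, hi⟩
  have hn := G.samples_cast_pos i
  have hv := G.meanVariance_nonneg
  -- The 9 of the theorem is 7 + 2: at most 7v from noise and at most 2v from bias.
  have h1 : G.meanNoise / G.size C ≤ 7 * G.meanVariance := by
    rw [div_le_iff₀ hN, mul_assoc]
    exact (not_le.1 hC').le
  have h2 : G.sqSize C / G.size C ^ 2 ≤ 1 :=
    div_le_one_of_le₀ (G.sqSize_le_size_sq C) (by positivity)
  have h3 : 0 ≤ 2 * (G.samples i : ℝ) / G.size C := by positivity
  have h4 : G.meanVariance * (G.sqSize C / G.size C ^ 2 + 1 - 2 * G.samples i / G.size C) ≤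
      G.meanVariance * 2 := mul_le_mul_of_nonneg_left (by linarith) hv
  have h5 : G.err i C ≤ 9 * G.meanVariance := by rw [G.err_eq hi]; linarith
  linarith [mul_le_mul_of_nonneg_left h5 hn.le]

theorem IsLight.coalitionCost_le (hnoise : 0 < G.meanNoise) {C : Finset ι} (hC : C.Nonempty)
    (hC' : G.IsLight C) : G.coalitionCost C ≤ 8 * G.meanNoise := by
  have hN := G.size_pos hC
  have h1 : 0 ≤ G.meanVariance * (G.sqSize C / G.size C) :=
    mul_nonneg G.meanVariance_nonneg (div_nonneg (G.sqSize_nonneg C) hN.le)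
  have h2 : 7 * (G.meanVariance * G.size C) ≤ G.meanNoise := hC'
  rw [G.coalitionCost_eq hC]
  linarith

theorem IsIndividuallyStable.cost_upper (h : G.IsIndividuallyStable P)
    (hnoise : 0 < G.meanNoise) :
    G.cost P ≤ ∑ i, G.cappedWeight i + 8 * G.meanNoise := by
  classical
  have hw : ∀ i, 0 ≤ G.cappedWeight i := fun i =>
    le_min hnoise.le (mul_nonneg (by norm_num)
      (mul_nonneg G.meanVariance_nonneg (G.samples_cast_pos i).le))
  have hC : ∀ C ∈ P.parts, G.coalitionCost C ≤
      ∑ i ∈ C, G.cappedWeight i + if G.IsLight C then 8 * G.meanNoise else 0 := fun C hC => by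
    split_ifs with hL
    · have := hL.coalitionCost_le hnoise (P.nonempty_of_mem_parts hC)
      have := Finset.sum_nonneg fun i (_ : i ∈ C) => hw i
      linarith
    · rw [add_zero]
      exact h.coalitionCost_le_of_not_light hC hL
  have hcard : ((P.parts.filter fun C => G.IsLight C).card : ℝ) ≤ 1 := by
    exact_mod_cast Finset.card_le_one.2 fun A hA B hB =>
      h.light_unique hnoise (Finset.mem_filter.1 hA).1 (Finset.mem_filter.1 hB).1
        (Finset.mem_filter.1 hA).2 (Finset.mem_filter.1 hB).2
  have hsum := Finset.sum_le_sum hC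
  rw [Finset.sum_add_distrib, sum_parts_sum, ← Finset.sum_filter, Finset.sum_const,
    nsmul_eq_mul] at hsum
  have := mul_le_mul_of_nonneg_right hcard (show 0 ≤ 8 * G.meanNoise by linarith)
  rw [cost]
  linarith

/-- The cost of every partition is positive. -/
theorem cost_pos [Nonempty ι] (hnoise : 0 < G.meanNoise)
    (P : Finpartition (Finset.univ : Finset ι)) : 0 < G.cost P := by
  have hw : 0 ≤ ∑ i, G.cappedWeight i := Finset.sum_nonneg fun i _ =>
    le_min hnoise.le (mul_nonneg (by norm_num)
      (mul_nonneg G.meanVariance_nonneg (G.samples_cast_pos i).le))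
  linarith [G.cost_lower hnoise P]

end MeanEstimation

theorem theorem2 {ι : Type*} [Fintype ι] [DecidableEq ι] [Nonempty ι] (G : MeanEstimation ι)
    (hnoise : 0 < G.meanNoise)
    (PM Popt : Finpartition (Finset.univ : Finset ι))
    (hM : G.IsWorstStable PM) (hopt : G.IsOptimal Popt) :
    0 < G.cost Popt ∧ G.cost PM / G.cost Popt ≤ 9 := by
  have hpos := MeanEstimation.cost_pos hnoise Popt
  refine ⟨hpos, (div_le_iff₀ hpos).2 ?_⟩
  exact (hM.1.cost_upper hnoise).trans (G.cost_lower hnoise Popt)
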